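/- Let $L/K$ be a finite separable field extension and let $H$ be a finite-dimensional Hopf algebra over $K$ with comultiplication $\Delta(h)=h_{(1)}\otimes h_{(2)}$, counit $\epsilon$ and antipode $S$. Suppose that $L/K$ is $H$-Galois, i.e. $L$ is a left $H$-module algebra ($h\cdot(xy)=(h_{(1)}\cdot x)(h_{(2)}\cdot y)$ and $h\cdot 1=\epsilon(h)1$) and the $K$-linear map $L\otimes_K H\to \mathrm{End}_K(L)$, $x\otimes h\mapsto (y\mapsto x(h\cdot y))$, is bijective. For an intermediate field $L_0$ put $J(L_0)=\{h\in H : h\cdot x=0 \text{ for all } x\in L_0\}$. Call $L_0$ an $H$-subextension if the map $L\otimes_K H/J(L_0)\to \mathrm{Hom}_K(L_0,L)$, $x\otimes\bar h\mapsto (y\mapsto x(h\cdot y))$, is bijective; $H$-stable if $h\cdot x\in L_0$ for all $h\in H$, $x\in L_0$; and $H$-normal if it is an $H$-stable $H$-subextension. For $F\subseteq H$ put $L^F=\{x\in L : h\cdot x=\epsilon(h)x \text{ for all } h\in F\}$. A two-sided coideal is a $K$-subspace $I\subseteq H$ with $\Delta(I)\subseteq H\otimes I+I\otimes H$ and $\epsilon(I)=0$;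 a Hopf subalgebra is a subalgebra $A\subseteq H$ with $\Delta(A)\subseteq A\otimes A$ and $S(A)\subseteq A$. Let $I_1,I_2\subseteq H$ be left ideals that are two-sided coideals, let $H_1,H_2\subseteq H$ be Hopf subalgebras, and let $L_1,L_2$ be $H$-subextensions with $L_1=L^{I_1}=L^{H_1}$ and $L_2=L^{I_2}=L^{H_2}$. Then: (a) The compositum $L_1L_2$ is an $H$-subextension and $L_1L_2=L^{H_1\cap H_2}$. If $L_1$ and $L_2$ are $H$-normal, then so is $L_1L_2$. (b) The intersection $L_1\cap L_2$ is an $H$-subextension and $L_1\cap L_2=L^{I_1+I_2}$. If $L_1$ and $L_2$ are $H$-normal, then so is $L_1\cap L_2$. -/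

import Mathlib

open scoped TensorProduct

namespace HopfGalois

section Action

variable (K L H : Type*) [Field K] [Field L] [Algebra K L] [Ring H] [HopfAlgebra K H]
  [Module H L] [IsScalarTower K H L]

/-- The orbit map `h ↦ h • x`, as a `K`-linear map `H → L`. -/
def orbitMap (x : L) : H →ₗ[K] L :=
  (LinearMap.toSpanSingleton H L x).restrictScalars K

/-- The action of `H` on `L`, restricted to a `K`-subspace `V` of `L`:
the `K`-linear map `H → Hom_K(V, L)`, `h ↦ (y ↦ h • y)`. -/
def actionOn (V : Submodule K L) : H →ₗ[K] (V →ₗ[K] L) where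
  toFun h :=
    { toFun := fun y => h • (y : L)
      map_add' := fun y z => by simp
      map_smul' := fun c y => by
        have e : h • (c • (y : L)) = c • (h • (y : L)) := by
          rw [← one_smul H (y : L), ← smul_assoc c (1 : H) (y : L), smul_smul, smul_smul,
            mul_one, mul_smul_comm, mul_one, smul_assoc]
        simpa using e }
  map_add' h h' := by
    ext y
    simp [add_smul]
  map_smul' c h := by
    ext y
    simp

/-- `L` is a left `H`-module algebra: the `H`-module structure of `L` satisfies
`h • (x y) = (h₍₁₎ • x) (h₍₂₎ • y)` and `h • 1 = ε(h) 1`. -/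
structure IsModuleAlgebra : Prop where
  smul_mul : ∀ (h : H) (x y : L),
    h • (x * y) =
      LinearMap.mul' K L
        (TensorProduct.map (orbitMap K L H x) (orbitMap K L H y) (Coalgebra.comul (R := K) h))
  smul_one : ∀ h : H, h • (1 : L) = algebraMap K L (Coalgebra.counit (R := K) h)

/-- The canonical (Galois) map `can : L ⊗ H → End_K(L)`, `can (x ⊗ h) (y) = x (h • y)`. -/
noncomputable def can : L ⊗[K] H →ₗ[K] (L →ₗ[K] L) :=
  TensorProduct.lift
    (LinearMap.mk₂ K (fun (x : L) (h : H) =>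
        LinearMap.mulLeft K x ∘ₗ actionOn K L H ⊤ h ∘ₗ Submodule.topEquiv.symm.toLinearMap)
      (fun x x' h => by ext y; simp [add_mul])
      (fun c x h => by ext y; simp)
      (fun x h h' => by ext y; simp [mul_add])
      (fun c x h => by ext y; simp))

/-- The field extension `L / K` is `H`-Galois. -/
structure IsHGalois : Prop where
  isModuleAlgebra : IsModuleAlgebra K L H
  bijective_can : Function.Bijective (can K L H)

/-- The annihilator `J(L₀) = {h ∈ H | h • x = 0 for all x ∈ L₀}`. -/
def annihilator (L₀ : IntermediateField K L) : Submodule K H :=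
  LinearMap.ker (actionOn K L H L₀.toSubalgebra.toSubmodule)

/-- The canonical map `can₀ : L ⊗ H/J(L₀) → Hom_K(L₀, L)`, `can₀ (x ⊗ h̄) (y) = x (h • y)`. -/
noncomputable def canOn (L₀ : IntermediateField K L) :
    L ⊗[K] (H ⧸ annihilator K L H L₀) →ₗ[K] (L₀.toSubalgebra.toSubmodule →ₗ[K] L) :=
  TensorProduct.lift
    (LinearMap.mk₂ K (fun (x : L) (q : H ⧸ annihilator K L H L₀) =>
        LinearMap.mulLeft K x ∘ₗ
          (annihilator K L H L₀).liftQ (actionOn K L H L₀.toSubalgebra.toSubmodule) le_rfl q)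
      (fun x x' q => by ext y; simp [add_mul])
      (fun c x q => by ext y; simp)
      (fun x q q' => by ext y; simp [mul_add])
      (fun c x q => by ext y; simp))

/-- The intermediate field `L₀` is an `H`-subextension of `L / K`: `can₀` is bijective. -/
def IsHSubextension (L₀ : IntermediateField K L) : Prop :=
  Function.Bijective (canOn K L H L₀)

/-- The intermediate field `L₀` is `H`-stable: `H • L₀ ⊆ L₀`. -/
def IsHStable (L₀ : IntermediateField K L) : Prop :=
  ∀ (h : H), ∀ x ∈ L₀, h • x ∈ L₀

/-- The intermediate field `L₀` is `H`-normal: it is an `H`-stable `H`-subextension. -/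
def IsHNormal (L₀ : IntermediateField K L) : Prop :=
  IsHSubextension K L H L₀ ∧ IsHStable K L H L₀

variable {H}

/-- The space of `F`-invariants `L^F = {x ∈ L | h • x = ε(h) x for all h ∈ F}`. -/
def invariants (F : Set H) : Set L :=
  {x | ∀ h ∈ F, h • x = Coalgebra.counit (R := K) h • x}

end Action

section Sub

variable {K H : Type*} [Field K] [Ring H] [HopfAlgebra K H]

/-- A left ideal of `H` that is a two-sided coideal. Here `Ideal H` is the type of left ideals. -/
def IsLeftIdealCoideal (I : Ideal H) : Prop :=
  (I.restrictScalars K).IsCoideal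

/-- A subalgebra `A` of `H` is a Hopf subalgebra: `Δ(A) ⊆ A ⊗ A` and `S(A) ⊆ A`. -/
structure IsHopfSubalgebra (A : Subalgebra K H) : Prop where
  comul_mem : ∀ a ∈ A, Coalgebra.comul (R := K) a ∈
    LinearMap.range (TensorProduct.map A.val.toLinearMap A.val.toLinearMap)
  antipode_mem : ∀ a ∈ A, HopfAlgebra.antipode K a ∈ A

end Sub

end HopfGalois

/-! Bijectivity of `can` identifies `L ⊗ H` with `End_K(L)`, so a subspace `V` of `H` can be studied
through the image of `L ⊗ V`, and `V ↦ L ⊗ V` respects intersections. For a left ideal `I`, this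
image is a left ideal of `End_K(L)`, hence contains every endomorphism killing the common kernel of
`I` (`mem_canImage_of_forall_eq_zero`). So any field that is such a kernel is an `H`-subextension;
this covers both the compositum and the intersection. For a Hopf subalgebra `A`, the image is a ring
acting simply on `L` whose commutant is multiplication by `L^A`; by Jacobson density it contains all
`L^A`-linear endomorphisms (`mem_canImage_of_forall_mul`). Hence `L₁L₂`-linear maps come from `L ⊗
(H₁ ∩ H₂)`, and this forces every `H₁ ∩ H₂`-invariant into `L₁L₂`. -/

namespace HopfGalois

/-! ### Subspaces of `H` seen inside `End_K(L)` -/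

section CanImage

variable {K L H : Type*} [Field K] [Field L] [Algebra K L] [Ring H] [HopfAlgebra K H]
  [Module H L] [IsScalarTower K H L]

@[simp] lemma orbitMap_apply (x : L) (h : H) : orbitMap K L H x h = h • x := rfl

@[simp] lemma can_tmul_apply (x : L) (h : H) (y : L) :
    can K L H (x ⊗ₜ h) y = x * h • y := rfl

lemma canOn_mk_tmul_apply (L₀ : IntermediateField K L) (t : L ⊗[K] H)
    (y : L₀.toSubalgebra.toSubmodule) :
    canOn K L H L₀ ((annihilator K L H L₀).mkQ.lTensor L t) y = can K L H t (y : L) := by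
  induction t with
  | zero => simp
  | tmul x h => rfl
  | add a b ha hb => simp [ha, hb]

lemma mem_annihilator {L₀ : IntermediateField K L} {h : H} :
    h ∈ annihilator K L H L₀ ↔ ∀ x ∈ L₀, h • x = 0 := by
  rw [annihilator, LinearMap.mem_ker, LinearMap.ext_iff]
  exact ⟨fun e x hx => e ⟨x, hx⟩, fun e x => e x x.2⟩

variable (L) in
/-- The image of `L ⊗ V` in `End_K(L)` under the canonical map, for a subspace `V` of `H`. -/
noncomputable def canImage (V : Submodule K H) : Submodule K (L →ₗ[K] L) :=
  Submodule.map₂ (TensorProduct.curry (can K L H)) ⊤ V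

lemma can_tmul_mem_canImage {V : Submodule K H} (x : L) {h : H} (hh : h ∈ V) :
    can K L H (x ⊗ₜ h) ∈ canImage L V :=
  Submodule.apply_mem_map₂ (TensorProduct.curry (can K L H)) Submodule.mem_top hh

lemma canImage_induction {V : Submodule K H} {p : (L →ₗ[K] L) → Prop} (h0 : p 0)
    (hadd : ∀ f g, p f → p g → p (f + g))
    (htmul : ∀ x : L, ∀ h ∈ V, p (can K L H (x ⊗ₜ h))) {f : L →ₗ[K] L}
    (hf : f ∈ canImage L V) : p f := by
  rw [canImage, Submodule.map₂_eq_span_image2] at hf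
  induction hf using Submodule.span_induction with
  | mem f hf => obtain ⟨x, -, h, hh, rfl⟩ := hf; exact htmul x h hh
  | zero => exact h0
  | add f g _ _ hf hg => exact hadd f g hf hg
  -- The span is over `K`; scalars are absorbed into the `L`-factor of the generators.
  | smul c f hf ih =>
    clear ih
    suffices h : ∀ c : K, p (c • f) from h c
    induction hf using Submodule.span_induction with
    | mem f hf =>
      obtain ⟨x, -, h, hh, rfl⟩ := hf
      intro c
      have := htmul (c • x) h hh
      rwa [← TensorProduct.smul_tmul', map_smul] at this
    | zero => intro c; simpa using h0
    | add f g _ _ hf hg => intro c; rw [smul_add]; exact hadd _ _ (hf c) (hg c)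
    | smul d f _ hf => intro c; rw [smul_smul]; exact hf _

lemma canImage_top (h : Function.Surjective (can K L H)) : canImage L (⊤ : Submodule K H) = ⊤ := by
  refine eq_top_iff.mpr fun f _ => ?_
  obtain ⟨t, rfl⟩ := h f
  induction t with
  | zero => simp
  | tmul x h => exact can_tmul_mem_canImage x Submodule.mem_top
  | add a b ha hb => rw [map_add]; exact add_mem (ha trivial) (hb trivial)

lemma can_mem_canImage_iff (hinj : Function.Injective (can K L H)) {ι : Type*} [DecidableEq ι]
    (b : Module.Basis ι K L) {V : Submodule K H} {t : L ⊗[K] H} :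
    can K L H t ∈ canImage L V ↔
      ∀ i, TensorProduct.equivFinsuppOfBasisLeft b t i ∈ V := by
  constructor
  · intro ht
    obtain ⟨s, hs, hst⟩ : ∃ s, (∀ i, TensorProduct.equivFinsuppOfBasisLeft b s i ∈ V) ∧
        can K L H s = can K L H t := by
      refine canImage_induction (p := fun f => ∃ s,
        (∀ i, TensorProduct.equivFinsuppOfBasisLeft b s i ∈ V) ∧ can K L H s = f) ?_ ?_ ?_ ht
      · exact ⟨0, by simp, by simp⟩
      · rintro _ _ ⟨s, hs, rfl⟩ ⟨s', hs', rfl⟩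
        exact ⟨s + s', fun i => by simpa using add_mem (hs i) (hs' i), by simp⟩
      · intro x h hh
        exact ⟨x ⊗ₜ h, fun i => by simpa using V.smul_mem _ hh, rfl⟩
    rwa [← hinj hst]
  · intro ht
    rw [← (TensorProduct.equivFinsuppOfBasisLeft b).symm_apply_apply t,
      TensorProduct.equivFinsuppOfBasisLeft_symm_apply, Finsupp.sum, map_sum]
    exact sum_mem fun i _ => can_tmul_mem_canImage _ (ht i)

/-- Coordinates in a `K`-basis of `L` detect membership, and they can be tested in `V` and `W`
separately. -/
lemma canImage_inf_le (h : Function.Bijective (can K L H)) (V W : Submodule K H) :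
    canImage L V ⊓ canImage L W ≤ canImage L (V ⊓ W) := by
  classical
  rintro f ⟨hV, hW⟩
  obtain ⟨t, rfl⟩ := h.2 f
  have b := Module.Free.chooseBasis K L
  rw [SetLike.mem_coe, can_mem_canImage_iff h.1 b] at hV hW
  exact (can_mem_canImage_iff h.1 b).mpr fun i => ⟨hV i, hW i⟩

lemma exists_mem_canImage_of_tensor {N : Type*} [AddCommGroup N] [Module K N] (φ : N →ₗ[K] H)
    {V : Submodule K H} (hV : ∀ n, ∀ v ∈ V, φ n * v ∈ V) (x y : L) {v : H} (hv : v ∈ V)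
    (s : N ⊗[K] N) :
    ∃ f ∈ canImage L V, ∀ z, f z = x * LinearMap.mul' K L
      (TensorProduct.map (orbitMap K L H y) (orbitMap K L H (v • z))
        (TensorProduct.map φ φ s)) := by
  induction s with
  | zero => exact ⟨0, zero_mem _, by simp⟩
  | tmul m n =>
    exact ⟨can K L H ((x * φ m • y) ⊗ₜ (φ n * v)), can_tmul_mem_canImage _ (hV n v hv),
      fun z => by simp [mul_smul, mul_assoc]⟩
  | add s t hs ht =>
    obtain ⟨f, hf, hf'⟩ := hs
    obtain ⟨g, hg, hg'⟩ := ht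
    exact ⟨f + g, add_mem hf hg, fun z => by simp [hf', hg', mul_add]⟩

/-- As operators, `h ∘ y = (h₍₁₎ • y) h₍₂₎`, so `V` need only be stable under the right-hand factors
of `Δ(h)`. The map `φ` is the identity for left ideals and the inclusion for Hopf subalgebras. -/
lemma can_comp_mem_canImage (hL : IsModuleAlgebra K L H) {N : Type*} [AddCommGroup N] [Module K N]
    (φ : N →ₗ[K] H) {V : Submodule K H} (hV : ∀ n, ∀ v ∈ V, φ n * v ∈ V) (x : L) {h : H}
    (hh : Coalgebra.comul (R := K) h ∈ LinearMap.range (TensorProduct.map φ φ))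
    {f : L →ₗ[K] L} (hf : f ∈ canImage L V) : can K L H (x ⊗ₜ h) ∘ₗ f ∈ canImage L V := by
  refine canImage_induction (p := fun f => can K L H (x ⊗ₜ h) ∘ₗ f ∈ canImage L V)
    (by simp) (fun f g hf hg => ?_) (fun y v hv => ?_) hf
  · rw [LinearMap.comp_add]; exact add_mem hf hg
  · obtain ⟨s, hs⟩ := hh
    obtain ⟨g, hg, hg'⟩ := exists_mem_canImage_of_tensor φ hV x y hv s
    convert hg using 1
    ext z
    rw [hg' z, hs, ← hL.smul_mul]
    rfl

end CanImage

/-! ### Left ideals and `H`-subextensions -/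

section LeftIdeal

variable {K L H : Type*} [Field K] [Field L] [Algebra K L] [Ring H] [HopfAlgebra K H]
  [Module H L] [IsScalarTower K H L]

lemma comp_mem_canImage (hGal : IsHGalois K L H) (I : Ideal H) (g : L →ₗ[K] L) {f : L →ₗ[K] L}
    (hf : f ∈ canImage L (I.restrictScalars K)) :
    g ∘ₗ f ∈ canImage L (I.restrictScalars K) := by
  have hg : g ∈ canImage L (⊤ : Submodule K H) := by
    rw [canImage_top hGal.bijective_can.2]; trivial
  refine canImage_induction (p := fun g => g ∘ₗ f ∈ canImage L (I.restrictScalars K))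
    (by simp) (fun g g' hg hg' => ?_) (fun x h _ => ?_) hg
  · rw [LinearMap.add_comp]; exact add_mem hg hg'
  · exact can_comp_mem_canImage hGal.isModuleAlgebra LinearMap.id
      (fun n v hv => I.mul_mem_left n hv) x (by simp) hf

/-- The left ideal of `End_K(L)` attached to a left ideal `I` of `H` consists of all
endomorphisms that vanish on the common kernel of `I`. -/
lemma mem_canImage_of_forall_eq_zero [FiniteDimensional K L] (hGal : IsHGalois K L H)
    (I : Ideal H) {f : L →ₗ[K] L} (hf : ∀ x : L, (∀ h ∈ I, h • x = 0) → f x = 0) :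
    f ∈ canImage L (I.restrictScalars K) := by
  set A := canImage L (I.restrictScalars K)
  have : Module.Free K A := Module.Free.of_divisionRing K A
  -- A basis of `A` bundled into one map `φ` has the common kernel as its kernel, so `f` factors
  -- through `φ`; the components of the factorization write `f` as a left combination of the basis.
  let b := Module.finBasis K A
  let φ : L →ₗ[K] (Fin (Module.finrank K A) → L) := LinearMap.pi fun i => (b i : L →ₗ[K] L)
  have hker : LinearMap.ker φ ≤ LinearMap.ker f := by
    intro x hx
    refine hf x fun h hh => ?_
    have hA : ∀ a : A, (a : L →ₗ[K] L) x = 0 := by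
      intro a
      rw [← b.sum_repr a]
      simp only [AddSubmonoidClass.coe_finsetSum, SetLike.val_smul, LinearMap.sum_apply,
        LinearMap.smul_apply]
      exact Finset.sum_eq_zero fun i _ => by
        rw [show (b i : L →ₗ[K] L) x = 0 from congrFun hx i, smul_zero]
    simpa using hA ⟨_, can_tmul_mem_canImage (1 : L) (V := I.restrictScalars K) hh⟩
  obtain ⟨g, hg⟩ : ∃ g, g ∘ₗ φ = f := by
    obtain ⟨g, hg⟩ := ((LinearMap.ker φ).liftQ f hker ∘ₗ
      φ.quotKerEquivRange.symm.toLinearMap).exists_extend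
    refine ⟨g, LinearMap.ext fun x => ?_⟩
    have := LinearMap.congr_fun hg ⟨φ x, x, rfl⟩
    simp only [LinearMap.comp_apply, Submodule.subtype_apply, LinearEquiv.coe_coe] at this
    rw [LinearMap.comp_apply, this, LinearMap.quotKerEquivRange_symm_apply_image φ x ⟨x, rfl⟩]
    rfl
  have hsum : f = ∑ i, (g ∘ₗ LinearMap.single K (fun _ => L) i) ∘ₗ (b i : L →ₗ[K] L) := by
    ext x
    rw [← hg]
    simp only [LinearMap.comp_apply, LinearMap.sum_apply, ← map_sum]
    congr 1
    exact (Finset.univ_sum_single (φ x)).symm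
  rw [hsum]
  exact sum_mem fun i _ => comp_mem_canImage hGal I _ (b i).2

/-- An intermediate field that is the common kernel of a left ideal is an `H`-subextension. -/
theorem isHSubextension_of_leftIdeal [FiniteDimensional K L] (hGal : IsHGalois K L H)
    (M : IntermediateField K L) (I : Ideal H) (hM : ∀ x, x ∈ M ↔ ∀ h ∈ I, h • x = 0) :
    IsHSubextension K L H M := by
  have hsurj : Function.Surjective ((annihilator K L H M).mkQ.lTensor L) :=
    LinearMap.lTensor_surjective L (Submodule.mkQ_surjective _)
  constructor
  · rw [← LinearMap.ker_eq_bot, LinearMap.ker_eq_bot']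
    intro q hq
    obtain ⟨t, rfl⟩ := hsurj q
    have ht : can K L H t ∈ canImage L (I.restrictScalars K) :=
      mem_canImage_of_forall_eq_zero hGal I fun x hx => by
        have := LinearMap.congr_fun hq ⟨x, (hM x).mpr hx⟩
        rwa [canOn_mk_tmul_apply] at this
    -- An element of `L ⊗ I` with the same image dies modulo the annihilator; injectivity of `can`
    -- identifies it with `t`.
    obtain ⟨s, hs, hst⟩ : ∃ s, (annihilator K L H M).mkQ.lTensor L s = 0 ∧
        can K L H s = can K L H t := by
      refine canImage_induction (p := fun f => ∃ s,
        (annihilator K L H M).mkQ.lTensor L s = 0 ∧ can K L H s = f) ?_ ?_ ?_ ht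
      · exact ⟨0, by simp, by simp⟩
      · rintro _ _ ⟨s, hs, rfl⟩ ⟨s', hs', rfl⟩
        exact ⟨s + s', by rw [map_add, hs, hs', add_zero], by simp⟩
      · intro x h hh
        have hJ : h ∈ annihilator K L H M := mem_annihilator.mpr fun x hx => (hM x).mp hx h hh
        exact ⟨x ⊗ₜ h, by
          rw [LinearMap.lTensor_tmul, Submodule.mkQ_apply, (Submodule.Quotient.mk_eq_zero _).mpr hJ,
            TensorProduct.tmul_zero], rfl⟩
    rwa [← hGal.bijective_can.1 hst]
  · intro f
    obtain ⟨g, rfl⟩ := f.exists_extend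
    obtain ⟨t, rfl⟩ := hGal.bijective_can.2 g
    exact ⟨_, LinearMap.ext fun y => canOn_mk_tmul_apply M t y⟩

end LeftIdeal

/-! ### Hopf subalgebras and double centralizers -/

section HopfSubalgebra

variable {K L H : Type*} [Field K] [Field L] [Algebra K L] [Ring H] [HopfAlgebra K H]
  [Module H L] [IsScalarTower K H L]

/-- A Hopf subalgebra acts linearly over its invariants. -/
lemma smul_mul_of_mem_invariants (hL : IsModuleAlgebra K L H) {A : Subalgebra K H}
    (hA : IsHopfSubalgebra A) {a : H} (ha : a ∈ A) {x : L} (hx : x ∈ invariants K L (A : Set H))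
    (y : L) : a • (x * y) = x * a • y := by
  obtain ⟨s, hs⟩ := hA.comul_mem a ha
  -- Left factors lie in `A`, so they act on `x` by `ε`; the counit axiom then collapses the sum.
  have key : ∀ s : A ⊗[K] A, LinearMap.mul' K L
      (TensorProduct.map (orbitMap K L H x) (orbitMap K L H y)
        (TensorProduct.map A.val.toLinearMap A.val.toLinearMap s)) =
      x * (TensorProduct.lid K H ((Coalgebra.counit (R := K) (A := H)).rTensor H
        (TensorProduct.map A.val.toLinearMap A.val.toLinearMap s))) • y := by
    intro s
    induction s with
    | zero => simp
    | tmul m n =>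
      have := hx m m.2
      simp [this, smul_assoc]
    | add s t hs ht => simp only [map_add, hs, ht, add_smul, mul_add]
  rw [hL.smul_mul, ← hs, key, hs, Coalgebra.rTensor_counit_comul]
  simp

/-- The image of `L ⊗ A` in `End_K(L)`, for a Hopf subalgebra `A`, as a subalgebra. -/
noncomputable def canSubalgebra (hL : IsModuleAlgebra K L H) {A : Subalgebra K H}
    (hA : IsHopfSubalgebra A) : Subalgebra K (Module.End K L) :=
  (canImage L (Subalgebra.toSubmodule A)).toSubalgebra
    (by
      convert can_tmul_mem_canImage (1 : L) (V := Subalgebra.toSubmodule A) A.one_mem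
      ext y; simp)
    (by
      intro f g hf hg
      refine canImage_induction
        (p := fun f => f ∘ₗ g ∈ canImage L (Subalgebra.toSubmodule A))
        (by simp) (fun f f' hf hf' => ?_) (fun x a ha => ?_) hf
      · rw [LinearMap.add_comp]; exact add_mem hf hf'
      · exact can_comp_mem_canImage hL A.val.toLinearMap (fun n v hv => A.mul_mem n.2 hv) x
          (hA.comul_mem a ha) hg)

/-- Multiplications by `L` alone already act transitively on nonzero vectors. -/
lemma isSimpleModule_canSubalgebra (hL : IsModuleAlgebra K L H) {A : Subalgebra K H}
    (hA : IsHopfSubalgebra A) : IsSimpleModule (canSubalgebra hL hA) L := by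
  refine (isSimpleModule_iff _ _).mpr { eq_bot_or_eq_top := fun N => ?_ }
  refine or_iff_not_imp_left.mpr fun hN => eq_top_iff.mpr fun y _ => ?_
  obtain ⟨u, hu, hu0⟩ := N.exists_mem_ne_zero_of_ne_bot hN
  have := N.smul_mem (⟨_, can_tmul_mem_canImage (y * u⁻¹) A.one_mem⟩ : canSubalgebra hL hA) hu
  convert this
  change y = y * u⁻¹ * (1 : H) • u
  rw [one_smul, inv_mul_cancel_right₀ hu0]

/-- The image of `L ⊗ A`, for a Hopf subalgebra `A`, contains all endomorphisms of `L` that are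
linear over the invariants of `A`. -/
lemma mem_canImage_of_forall_mul [FiniteDimensional K L] (hL : IsModuleAlgebra K L H)
    {A : Subalgebra K H} (hA : IsHopfSubalgebra A) {f : L →ₗ[K] L}
    (hf : ∀ x ∈ invariants K L (A : Set H), ∀ y, f (x * y) = x * f y) :
    f ∈ canImage L (Subalgebra.toSubmodule A) := by
  classical
  let B := canSubalgebra hL hA
  have : IsSimpleModule B L := isSimpleModule_canSubalgebra hL hA
  -- Commuting with `L` makes `φ` multiplication by `φ 1`; commuting with `A` makes `φ 1` invariant.
  have hφ : ∀ φ : Module.End B L, φ 1 ∈ invariants K L (A : Set H) ∧ ∀ y, φ y = φ 1 * y := by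
    intro φ
    have hmul : ∀ (x : L) {a : H}, a ∈ A → ∀ y, φ (x * a • y) = x * a • φ y := fun x a ha y =>
      φ.map_smul (⟨_, can_tmul_mem_canImage x ha⟩ : B) y
    have hy : ∀ y, φ y = φ 1 * y := fun y => by
      have := hmul y A.one_mem 1
      rwa [one_smul, one_smul, mul_one, mul_comm] at this
    refine ⟨fun a ha => ?_, hy⟩
    have := hmul 1 ha 1
    rw [one_mul, one_mul, hL.smul_one, hy, mul_comm] at this
    rw [← this, Algebra.smul_def]
  let F : Module.End (Module.End B L) L :=
    { toFun := f
      map_add' := map_add f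
      map_smul' := fun φ y => by
        change f (φ y) = φ (f y)
        rw [(hφ φ).2 y, (hφ φ).2 (f y), hf _ (hφ φ).1] }
  let b := Module.finBasis K L
  -- Density on a finite `K`-basis gives equality everywhere.
  obtain ⟨r, hr⟩ := jacobson_density (R := B) F (Finset.univ.image b)
  have : f = (r : Module.End K L) := b.ext fun i => hr (b i) (by simp)
  rw [this]
  exact r.2

end HopfSubalgebra

lemma IsLeftIdealCoideal.counit_eq_zero {K H : Type*} [Field K] [Ring H] [HopfAlgebra K H]
    {I : Ideal H} (hI : IsLeftIdealCoideal (K := K) I) {h : H} (hh : h ∈ I) :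
    Coalgebra.counit (R := K) h = 0 :=
  Submodule.IsCoideal.counit_eq_zero (self := hI) hh

lemma IsHStable.inf {K L H : Type*} [Field K] [Field L] [Algebra K L] [Ring H]
    [Module H L] {L₁ L₂ : IntermediateField K L}
    (h₁ : IsHStable K L H L₁) (h₂ : IsHStable K L H L₂) : IsHStable K L H (L₁ ⊓ L₂) :=
  fun h x hx => ⟨h₁ h x hx.1, h₂ h x hx.2⟩

section Invariants

variable {K L H : Type*} [Field K] [Field L] [Algebra K L] [Ring H] [HopfAlgebra K H]
  [Module H L] [IsScalarTower K H L]

/-- The invariants of a subalgebra `A` are the common kernel of the left ideal generated by the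
elements `a - ε(a)`. -/
lemma mem_invariants_iff_span (A : Subalgebra K H) (x : L) :
    x ∈ invariants K L (A : Set H) ↔
      ∀ h ∈ Ideal.span ((fun a : H => a - algebraMap K H (Coalgebra.counit a)) '' (A : Set H)),
        h • x = 0 := by
  constructor
  · intro hx h hh
    induction hh using Submodule.span_induction with
    | mem h hh =>
      obtain ⟨a, ha, rfl⟩ := hh
      rw [sub_smul, hx a ha, algebraMap_smul, sub_self]
    | zero => exact zero_smul H x
    | add a b _ _ ha hb => rw [add_smul, ha, hb, add_zero]
    | smul c a _ ha => rw [smul_assoc, ha, smul_zero]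
  · intro hx a ha
    have := hx _ (Ideal.subset_span ⟨a, ha, rfl⟩)
    rwa [sub_smul, algebraMap_smul, sub_eq_zero] at this

lemma mem_invariants_iff_of_isLeftIdealCoideal {I : Ideal H}
    (hI : IsLeftIdealCoideal (K := K) I) (x : L) :
    x ∈ invariants K L (I : Set H) ↔ ∀ h ∈ I, h • x = 0 := by
  refine forall₂_congr fun h hh => ?_
  rw [hI.counit_eq_zero hh, zero_smul]

end Invariants

/-! ### Compositum and intersected Hopf subalgebras -/

section Compositum

variable {K L H : Type*} [Field K] [Field L] [Algebra K L] [FiniteDimensional K L]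
  [Ring H] [HopfAlgebra K H] [Module H L] [IsScalarTower K H L]

/-- To prove a property of all elements of a compositum, it suffices to prove it for the elements
of both fields and to show that it is compatible with sums and products. -/
lemma sup_induction {L₁ L₂ : IntermediateField K L} {p : L → Prop}
    (h₁ : ∀ x ∈ L₁, p x) (h₂ : ∀ x ∈ L₂, p x) (hadd : ∀ x y, p x → p y → p (x + y))
    (hmul : ∀ x y, p x → p y → p (x * y)) {x : L} (hx : x ∈ L₁ ⊔ L₂) : p x := by
  rw [← IntermediateField.mem_toSubalgebra,
    IntermediateField.sup_toSubalgebra_of_isAlgebraic_left] at hx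
  let S : Subalgebra K L :=
    { carrier := {x | p x}
      mul_mem' := fun {x y} => hmul x y
      add_mem' := fun {x y} => hadd x y
      algebraMap_mem' := fun c => h₁ _ (L₁.algebraMap_mem c) }
  exact (sup_le (fun x hx => h₁ x hx) (fun x hx => h₂ x hx) :
    L₁.toSubalgebra ⊔ L₂.toSubalgebra ≤ S) hx

lemma IsHStable.sup (hL : IsModuleAlgebra K L H) {L₁ L₂ : IntermediateField K L}
    (h₁ : IsHStable K L H L₁) (h₂ : IsHStable K L H L₂) : IsHStable K L H (L₁ ⊔ L₂) := by
  intro h x hx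
  revert h
  refine sup_induction (fun x hx h => le_sup_left (a := L₁) (h₁ h x hx))
    (fun x hx h => le_sup_right (a := L₁) (h₂ h x hx))
    (fun x y hx hy h => by rw [smul_add]; exact add_mem (hx h) (hy h)) (fun x y hx hy h => ?_) hx
  rw [hL.smul_mul]
  induction Coalgebra.comul (R := K) h with
  | zero => simp
  | tmul m n => simpa using mul_mem (hx m) (hy n)
  | add s t hs ht => simpa only [map_add] using add_mem hs ht

/-- The compositum of the invariants of two Hopf subalgebras is the field of invariants of their
intersection. -/
theorem coe_sup_eq_invariants (hGal : IsHGalois K L H) {L₁ L₂ : IntermediateField K L}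
    {H₁ H₂ : Subalgebra K H} (hH₁ : IsHopfSubalgebra H₁) (hH₂ : IsHopfSubalgebra H₂)
    (h₁ : (L₁ : Set L) = invariants K L (H₁ : Set H))
    (h₂ : (L₂ : Set L) = invariants K L (H₂ : Set H)) :
    ((L₁ ⊔ L₂ : IntermediateField K L) : Set L) =
      invariants K L ((H₁ ⊓ H₂ : Subalgebra K H) : Set H) := by
  have hL := hGal.isModuleAlgebra
  refine Set.Subset.antisymm (fun x hx c hc => ?_) (fun x hx => ?_)
  · have key : ∀ y, c • (x * y) = x * c • y := by
      refine sup_induction (p := fun x => ∀ y, c • (x * y) = x * c • y) ?_ ?_ ?_ ?_ hx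
      · exact fun x hx y => smul_mul_of_mem_invariants hL hH₁ hc.1 (h₁ ▸ hx) y
      · exact fun x hx y => smul_mul_of_mem_invariants hL hH₂ hc.2 (h₂ ▸ hx) y
      · exact fun x x' hx hx' y => by rw [add_mul, smul_add, hx, hx', add_mul]
      · exact fun x x' hx hx' y => by rw [mul_assoc, hx, hx', mul_assoc]
    have := key 1
    rwa [hL.smul_one, mul_one, mul_comm, ← Algebra.smul_def] at this
  · by_contra hxM
    set M := L₁ ⊔ L₂
    have hspan : x ∉ Submodule.span M {(1 : L)} := fun h => by
      obtain ⟨m, rfl⟩ := Submodule.mem_span_singleton.mp h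
      refine hxM ?_
      rw [Algebra.smul_def, mul_one]
      exact m.2
    -- An `M`-linear functional killing `1` but not `x`: its image in `L ⊗ (H₁ ∩ H₂)` would force `f
    -- x = f 1 * x = 0`.
    obtain ⟨g, hgx, hg⟩ := Submodule.exists_le_ker_of_notMem hspan
    let f : L →ₗ[K] L := (M.val.toLinearMap) ∘ₗ g.restrictScalars K
    have hf : ∀ m ∈ M, ∀ y, f (m * y) = m * f y := fun m hm y =>
      congrArg Subtype.val (g.map_smul (⟨m, hm⟩ : M) y)
    have hmem : f ∈ canImage L (Subalgebra.toSubmodule H₁ ⊓ Subalgebra.toSubmodule H₂) :=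
      canImage_inf_le hGal.bijective_can _ _
        ⟨mem_canImage_of_forall_mul hL hH₁ fun m hm => hf m (le_sup_left (a := L₁) (h₁ ▸ hm :)),
          mem_canImage_of_forall_mul hL hH₂ fun m hm => hf m (le_sup_right (a := L₁) (h₂ ▸ hm :))⟩
    have hfx : f x = f 1 * x := by
      refine canImage_induction (p := fun f => f x = f 1 * x) (by simp)
        (fun f g hf hg => by simp [hf, hg, add_mul]) (fun y c hc => ?_) hmem
      rw [can_tmul_apply, can_tmul_apply, hx c hc, hL.smul_one, Algebra.smul_def, mul_assoc]
    have hf1 : f 1 = 0 :=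
      congrArg Subtype.val (LinearMap.mem_ker.mp (hg (Submodule.mem_span_singleton_self 1)))
    rw [hf1, zero_mul] at hfx
    exact hgx (Subtype.ext hfx)

end Compositum

end HopfGalois

theorem mainTheorem8 {K L H : Type*} [Field K] [Field L] [Algebra K L]
    [FiniteDimensional K L] [Algebra.IsSeparable K L]
    [Ring H] [HopfAlgebra K H] [FiniteDimensional K H] [Module H L] [IsScalarTower K H L]
    (hGal : HopfGalois.IsHGalois K L H)
    (L₁ L₂ : IntermediateField K L)
    (hL₁ : HopfGalois.IsHSubextension K L H L₁) (hL₂ : HopfGalois.IsHSubextension K L H L₂)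
    (I₁ I₂ : Ideal H)
    (hI₁ : HopfGalois.IsLeftIdealCoideal (K := K) I₁)
    (hI₂ : HopfGalois.IsLeftIdealCoideal (K := K) I₂)
    (H₁ H₂ : Subalgebra K H)
    (hH₁ : HopfGalois.IsHopfSubalgebra H₁) (hH₂ : HopfGalois.IsHopfSubalgebra H₂)
    (hLI₁ : (L₁ : Set L) = HopfGalois.invariants K L (I₁ : Set H))
    (hLH₁ : (L₁ : Set L) = HopfGalois.invariants K L (H₁ : Set H))
    (hLI₂ : (L₂ : Set L) = HopfGalois.invariants K L (I₂ : Set H))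
    (hLH₂ : (L₂ : Set L) = HopfGalois.invariants K L (H₂ : Set H)) :
    (HopfGalois.IsHSubextension K L H (L₁ ⊔ L₂) ∧
      ((L₁ ⊔ L₂ : IntermediateField K L) : Set L) =
        HopfGalois.invariants K L ((H₁ ⊓ H₂ : Subalgebra K H) : Set H) ∧
      (HopfGalois.IsHNormal K L H L₁ → HopfGalois.IsHNormal K L H L₂ →
        HopfGalois.IsHNormal K L H (L₁ ⊔ L₂))) ∧
    (HopfGalois.IsHSubextension K L H (L₁ ⊓ L₂) ∧
      ((L₁ ⊓ L₂ : IntermediateField K L) : Set L) =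
        HopfGalois.invariants K L ((I₁ ⊔ I₂ : Ideal H) : Set H) ∧
      (HopfGalois.IsHNormal K L H L₁ → HopfGalois.IsHNormal K L H L₂ →
        HopfGalois.IsHNormal K L H (L₁ ⊓ L₂))) := by
  have hL := hGal.isModuleAlgebra
  have hsup := HopfGalois.coe_sup_eq_invariants hGal hH₁ hH₂ hLH₁ hLH₂
  have hsupSub : HopfGalois.IsHSubextension K L H (L₁ ⊔ L₂) :=
    HopfGalois.isHSubextension_of_leftIdeal hGal _ _ fun x => by
      rw [← HopfGalois.mem_invariants_iff_span (H₁ ⊓ H₂), ← hsup, SetLike.mem_coe]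
  have h₁ : ∀ x, x ∈ L₁ ↔ ∀ h ∈ I₁, h • x = 0 := fun x => by
    rw [← HopfGalois.mem_invariants_iff_of_isLeftIdealCoideal hI₁, ← hLI₁, SetLike.mem_coe]
  have h₂ : ∀ x, x ∈ L₂ ↔ ∀ h ∈ I₂, h • x = 0 := fun x => by
    rw [← HopfGalois.mem_invariants_iff_of_isLeftIdealCoideal hI₂, ← hLI₂, SetLike.mem_coe]
  have hinf : ∀ x, x ∈ L₁ ⊓ L₂ ↔ ∀ h ∈ I₁ ⊔ I₂, h • x = 0 := fun x => by
    rw [IntermediateField.mem_inf, h₁, h₂]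
    refine ⟨fun hx h hh => ?_, fun hx =>
      ⟨fun h hh => hx h (Ideal.mem_sup_left hh), fun h hh => hx h (Ideal.mem_sup_right hh)⟩⟩
    obtain ⟨a, ha, b, hb, rfl⟩ := Submodule.mem_sup.mp hh
    rw [add_smul, hx.1 a ha, hx.2 b hb, add_zero]
  have hinfSub := HopfGalois.isHSubextension_of_leftIdeal hGal _ _ hinf
  refine ⟨⟨hsupSub, hsup, fun n₁ n₂ => ⟨hsupSub, n₁.2.sup hL n₂.2⟩⟩,
    ⟨hinfSub, ?_, fun n₁ n₂ => ⟨hinfSub, n₁.2.inf n₂.2⟩⟩⟩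
  ext x
  rw [SetLike.mem_coe, hinf]
  refine forall₂_congr fun h hh => ?_
  obtain ⟨a, ha, b, hb, rfl⟩ := Submodule.mem_sup.mp hh
  rw [map_add, hI₁.counit_eq_zero ha, hI₂.counit_eq_zero hb,
    add_zero, zero_smul]
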